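/- **Setting.** Let $G$ be a locally compact Hausdorff abelian group whose topology has a countable basis. Let $C_c(G)$ be the space of complex-valued continuous functions on $G$ with compact support, with the locally convex inductive limit topology of the spaces $C_K(G)=\{\varphi\in C_c(G):\operatorname{supp}\varphi\subset K\}$ ($K\subset G$ compact), each with the supremum norm. Put $(\tau_t\varphi)(s)=\varphi(s-t)$. A *spatial process* $\mathcal N=(N,X,m,T)$ over $G$ consists of a measurable space $X$ with an action $\alpha$ of $G$ that is measurable in each variable, a $G$-invariant probability measure $m$ on $X$, the Koopman representation $T_tf=f\circ\alpha_{-t}$ on $L^2(X,m)$, and a continuous linear map $N:C_c(G)\to L^2(X,m)$ with $\overline{N(\varphi)}=N(\overline\varphi)$ and $T_t\circ N=N\circ\tau_t$ for all $\varphi\in C_c(G)$, $t\in G$. (A continuous action on a compact Hausdorff space with its Borel $\sigma$-algebra is a special case.) It is *full* if the linear span of all products $\vartheta_1(N(\varphi_1))\cdots\vartheta_n(N(\varphi_n))$, with $n\ge 1$, $\vartheta_j\in C_c(\mathbb C)$ and $\varphi_j\in C_c(G)$, is dense in $L^2(X,m)$. Two spatial processes $(N,X,m,T)$ and $(N',X',m',T')$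 over $G$ are *spatially isomorphic* (equivalent) if there is a unitary map $U:L^2(X,m)\to L^2(X',m')$ such that $U\circ N=N'$; $U\circ T_t=T'_t\circ U$ for all $t\in G$; $U(fg)=U(f)U(g)$ for all $f,g\in L^\infty(X,m)$; and $U^{-1}(f'g')=U^{-1}(f')U^{-1}(g')$ for all $f',g'\in L^\infty(X',m')$. Let $\mathcal M^+(G)$ be the set of positive measures on $G$, i.e. of continuous linear functionals $\nu$ on $C_c(G)$ with $\nu(\varphi)\ge 0$ whenever $\varphi\ge 0$, with the vague (weak-$*$) topology, its Borel $\sigma$-algebra, and the action $(\alpha_t\nu)(\varphi)=\nu(\tau_{-t}\varphi)$. A *positive measure dynamical system* (PMDS) is the spatial process $(N',\mathcal M^+(G),m',T')$ given by a $G$-invariant probability measure $m'$ on $\mathcal M^+(G)$ that is square integrable, i.e. $\int|\nu(\varphi)|^2\,dm'(\nu)<\infty$ for all $\varphi\in C_c(G)$, with $N'(\varphi)(\nu)=\nu(\varphi)$ and with $T'$ the Koopman representation. **Theorem.** Let $\mathcal N=(N,X,m,T)$ be a full spatial process over $G$ such that $N(\varphi)\ge 0$ ($m$-almost everywhere) for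 all $\varphi\in C_c(G)$ with $\varphi\ge 0$. Then $\mathcal N$ is spatially isomorphic to a positive measure dynamical system. -/

import Mathlib

open MeasureTheory Filter Topology
open scoped ENNReal CompactlySupported ComplexOrder BoundedContinuousFunction

/-! ### The space `C_c(G)` with its inductive limit topology -/

namespace CcSpace

section Basic

variable {G : Type*} [TopologicalSpace G]

/-- A compactly supported continuous function, regarded as a bounded continuous function. -/
noncomputable def toBCF (φ : C_c(G, ℂ)) : G →ᵇ ℂ :=
  BoundedContinuousFunction.ofNormedAddCommGroup φ φ.continuous
    (Classical.choose (φ.continuous.bounded_above_of_compact_support φ.hasCompactSupport))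
    (Classical.choose_spec (φ.continuous.bounded_above_of_compact_support φ.hasCompactSupport))

@[simp] theorem toBCF_apply (φ : C_c(G, ℂ)) (s : G) : toBCF φ s = φ s := rfl

/-- `C_K(G)`: the functions in `C_c(G)` whose support is contained in the compact set `K`. -/
def SupportedIn (K : TopologicalSpace.Compacts G) : Type _ :=
  {φ : C_c(G, ℂ) // tsupport φ ⊆ (K : Set G)}

/-- `C_K(G)` carries the topology of the supremum norm. -/
noncomputable instance (K : TopologicalSpace.Compacts G) : TopologicalSpace (SupportedIn K) :=
  TopologicalSpace.induced (fun φ => toBCF φ.1) inferInstance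

variable (G) in
/-- The final topology on `C_c(G)` for the inclusions `C_K(G) → C_c(G)`; in general it is not a
vector space topology. -/
@[reducible]
noncomputable def finalTop : TopologicalSpace C_c(G, ℂ) :=
  ⨆ K : TopologicalSpace.Compacts G,
    TopologicalSpace.coinduced (fun φ : SupportedIn K => φ.1) inferInstance

/-- The locally convex inductive limit topology on `C_c(G)`: the finest locally convex vector space
topology for which all inclusions `C_K(G) → C_c(G)` are continuous. -/
noncomputable instance topology : TopologicalSpace C_c(G, ℂ) :=
  sInf {t : TopologicalSpace C_c(G, ℂ) | finalTop G ≤ t ∧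
    @IsTopologicalAddGroup C_c(G, ℂ) t _ ∧
    @ContinuousSMul ℂ C_c(G, ℂ) _ _ t ∧
    @LocallyConvexSpace ℝ C_c(G, ℂ) _ _ _ _ t}

instance : IsTopologicalAddGroup C_c(G, ℂ) :=
  topologicalAddGroup_sInf fun _ ⟨_, ht, _, _⟩ => ht

instance : ContinuousSMul ℂ C_c(G, ℂ) :=
  continuousSMul_sInf fun _ ⟨_, _, ht, _⟩ => ht

instance : LocallyConvexSpace ℝ C_c(G, ℂ) :=
  .sInf fun _ ⟨_, _, _, ht⟩ => ht

theorem continuous_inclusion (K : TopologicalSpace.Compacts G) :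
    Continuous (fun φ : SupportedIn K => φ.1) := by
  rw [continuous_iff_coinduced_le]
  exact le_trans (le_iSup (fun K : TopologicalSpace.Compacts G =>
    TopologicalSpace.coinduced (fun φ : SupportedIn K => φ.1) inferInstance) K)
    (le_sInf fun _ ⟨ht, _⟩ => ht)

/-- A linear map from `C_c(G)` to a locally convex space is continuous as soon as its restriction
to every `C_K(G)` is. -/
theorem continuous_of_restrict {E : Type*} [AddCommGroup E] [Module ℂ E] [Module ℝ E]
    [IsScalarTower ℝ ℂ E] [TopologicalSpace E] [IsTopologicalAddGroup E] [ContinuousSMul ℂ E]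
    [LocallyConvexSpace ℝ E] (f : C_c(G, ℂ) →ₗ[ℂ] E)
    (hf : ∀ K : TopologicalSpace.Compacts G, Continuous (fun φ : SupportedIn K => f φ.1)) :
    Continuous f := by
  rw [continuous_iff_le_induced]
  refine sInf_le ⟨?_, topologicalAddGroup_induced f, continuousSMul_induced f, ?_⟩
  · refine iSup_le fun K => ?_
    rw [← continuous_iff_coinduced_le, continuous_induced_rng]
    exact hf K
  · exact LocallyConvexSpace.induced (f.restrictScalars ℝ)

theorem tsupport_sub_subset {K : Set G} {φ ψ : C_c(G, ℂ)} (hφ : tsupport φ ⊆ K)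
    (hψ : tsupport ψ ⊆ K) : tsupport (φ - ψ : C_c(G, ℂ)) ⊆ K := by
  have h : tsupport (φ - ψ : C_c(G, ℂ)) ⊆ tsupport φ ∪ tsupport ψ := by
    rw [CompactlySupportedContinuousMap.coe_sub]
    exact tsupport_sub _ _
  exact h.trans (Set.union_subset hφ hψ)

/-- A linear map into a normed space which is bounded on every `C_K(G)` is continuous. -/
theorem continuous_of_bound {E : Type*} [NormedAddCommGroup E] [NormedSpace ℂ E]
    (f : C_c(G, ℂ) →ₗ[ℂ] E)
    (hf : ∀ K : TopologicalSpace.Compacts G, ∃ C : ℝ, ∀ φ : C_c(G, ℂ),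
      tsupport φ ⊆ (K : Set G) → ‖f φ‖ ≤ C * ‖toBCF φ‖) : Continuous f := by
  let _ : NormedSpace ℝ E := NormedSpace.restrictScalars ℝ ℂ E
  have : IsScalarTower ℝ ℂ E := RestrictScalars.isScalarTower ℝ ℂ E
  refine continuous_of_restrict f fun K => ?_
  obtain ⟨C, hC⟩ := hf K
  rw [continuous_iff_continuousAt]
  intro φ
  have hlim : Tendsto (fun ψ : SupportedIn K => C * ‖toBCF ψ.1 - toBCF φ.1‖) (𝓝 φ) (𝓝 0) := by
    have hc : Continuous (fun ψ : SupportedIn K => toBCF ψ.1) := continuous_induced_dom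
    have h2 : Continuous (fun ψ : SupportedIn K => C * ‖toBCF ψ.1 - toBCF φ.1‖) := by fun_prop
    simpa using h2.tendsto φ
  rw [ContinuousAt, tendsto_iff_norm_sub_tendsto_zero]
  refine squeeze_zero (fun _ => norm_nonneg _) (fun ψ => ?_) hlim
  have h := hC (ψ.1 - φ.1) (tsupport_sub_subset ψ.2 φ.2)
  rw [map_sub] at h
  exact h

end Basic

section Translation

variable {G : Type*} [AddCommGroup G] [TopologicalSpace G] [IsTopologicalAddGroup G]

/-- The translate `s ↦ φ (s - t)` of `φ`. -/
noncomputable def translateFun (t : G) (φ : C_c(G, ℂ)) : C_c(G, ℂ) where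
  toFun s := φ (s - t)
  continuous_toFun := φ.continuous.comp (continuous_sub_right t)
  hasCompactSupport' := φ.hasCompactSupport.comp_homeomorph (Homeomorph.subRight t)

/-- For fixed `φ`, the translates of `φ` by `t` depend continuously on `t`. -/
theorem continuous_translateFun [LocallyCompactSpace G] (φ : C_c(G, ℂ)) :
    Continuous (fun t : G => translateFun t φ) := by
  rw [continuous_iff_continuousAt]
  intro t₀
  obtain ⟨V, hV, hVt⟩ := exists_compact_mem_nhds t₀
  let K : TopologicalSpace.Compacts G := ⟨(fun p : G × G => p.1 + p.2) '' (tsupport φ ×ˢ V),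
    (φ.hasCompactSupport.isCompact.prod hV).image continuous_add⟩
  have hsupp : ∀ t : V, tsupport (translateFun t.1 φ) ⊆ (K : Set G) := by
    intro t s hs
    have h1 : tsupport (translateFun t.1 φ) = (fun s => s - t.1) ⁻¹' tsupport φ :=
      tsupport_comp_eq_preimage φ (Homeomorph.subRight t.1)
    rw [h1] at hs
    exact ⟨(s - t.1, t.1), ⟨hs, t.2⟩, sub_add_cancel s t.1⟩
  let g : V → SupportedIn K := fun t => ⟨translateFun t.1 φ, hsupp t⟩
  have hunif : Continuous (fun t : G => toBCF (translateFun t φ)) := by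
    rw [continuous_iff_continuousAt]
    intro t₁
    rw [ContinuousAt, BoundedContinuousFunction.tendsto_iff_tendstoUniformly,
      Metric.tendstoUniformly_iff]
    intro ε hε
    let _ : UniformSpace G := IsTopologicalAddGroup.rightUniformSpace G
    have : IsUniformAddGroup G := isUniformAddGroup_of_addCommGroup
    have hu : UniformContinuous φ :=
      φ.hasCompactSupport.uniformContinuous_of_continuous φ.continuous
    have h := hu (Metric.dist_mem_uniformity hε)
    rw [uniformity_eq_comap_nhds_zero, mem_map, mem_comap] at h
    obtain ⟨U, hU, hUs⟩ := h
    have hlim : Tendsto (fun t : G => t₁ - t) (𝓝 t₁) (𝓝 0) := by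
      have hc : Continuous (fun t : G => t₁ - t) := by fun_prop
      simpa using hc.tendsto t₁
    filter_upwards [hlim hU] with t ht s
    refine hUs (a := (s - t₁, s - t)) ?_
    have h2 : s - t - (s - t₁) = t₁ - t := by abel
    simpa [h2] using ht
  have hg : Continuous g := by
    rw [continuous_induced_rng]
    exact hunif.comp continuous_subtype_val
  have hres : ContinuousOn (fun t : G => translateFun t φ) V :=
    continuousOn_iff_continuous_domRestrict.2 ((continuous_inclusion K).comp hg)
  exact hres.continuousAt hVt

/-- Translation `τ_t` on `C_c(G)`, given by `(τ_t φ)(s) = φ (s - t)`. -/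
noncomputable def translate (t : G) : C_c(G, ℂ) →L[ℂ] C_c(G, ℂ) where
  toFun := translateFun t
  map_add' _ _ := rfl
  map_smul' _ _ := rfl
  cont := by
    let f : C_c(G, ℂ) →ₗ[ℂ] C_c(G, ℂ) :=
      { toFun := translateFun t, map_add' := fun _ _ => rfl, map_smul' := fun _ _ => rfl }
    refine continuous_of_restrict f fun K => ?_
    let K' : TopologicalSpace.Compacts G := K.map (fun s => s + t) (continuous_add_const t)
    have hsupp : ∀ φ : SupportedIn K, tsupport (translateFun t φ.1) ⊆ (K' : Set G) := by
      intro φ s hs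
      have h1 : tsupport (translateFun t φ.1) = (fun s => s - t) ⁻¹' tsupport φ.1 :=
        tsupport_comp_eq_preimage φ.1 (Homeomorph.subRight t)
      rw [h1] at hs
      exact ⟨s - t, φ.2 hs, sub_add_cancel s t⟩
    let g : SupportedIn K → SupportedIn K' := fun φ => ⟨translateFun t φ.1, hsupp φ⟩
    have hg : Continuous g := by
      rw [continuous_induced_rng]
      have hc : Continuous (fun φ : SupportedIn K => toBCF φ.1) := continuous_induced_dom
      exact (BoundedContinuousFunction.continuous_compContinuous
        ⟨fun s => s - t, continuous_sub_right t⟩).comp hc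
    exact (continuous_inclusion K').comp hg

@[simp] theorem translate_apply (t : G) (φ : C_c(G, ℂ)) (s : G) :
    translate t φ s = φ (s - t) := rfl

end Translation

end CcSpace

/-! ### Spatial processes -/

section SpatialProcesses

variable {G : Type*} [AddCommGroup G] [MeasurableSpace G]

/-- The Koopman operator `T_t f = f ∘ α_{-t}` on `L²(X, m)`, where `α_t x = t +ᵥ x`. -/
noncomputable def koopman {X : Type*} [MeasurableSpace X] [AddAction G X] [MeasurableVAdd G X]
    (m : Measure X) [VAddInvariantMeasure G X m] (t : G) : Lp ℂ 2 m →ₗᵢ[ℂ] Lp ℂ 2 m :=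
  Lp.compMeasurePreservingₗᵢ ℂ (fun x => -t +ᵥ x) (measurePreserving_vadd (-t) m)

variable [TopologicalSpace G] [IsTopologicalAddGroup G]

variable (G) in
/-- A spatial process over `G` on a measurable dynamical system `X`, that is, a measurable space
with an action of `G` which is measurable in each variable. -/
structure SpatialProcess (X : Type*) [MeasurableSpace X] [AddAction G X] [MeasurableVAdd G X] where
  /-- the underlying measure -/
  m : Measure X
  isProbabilityMeasure : IsProbabilityMeasure m
  invariant : VAddInvariantMeasure G X m
  /-- the linear and continuous map `N : C_c(G) → L²(X, m)` -/
  N : C_c(G, ℂ) →L[ℂ] Lp ℂ 2 m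
  star_N : ∀ φ : C_c(G, ℂ), star (N φ) = N (star φ)
  koopman_N : ∀ (t : G) (φ : C_c(G, ℂ)), koopman m t (N φ) = N (CcSpace.translate t φ)

namespace SpatialProcess

attribute [instance] SpatialProcess.isProbabilityMeasure SpatialProcess.invariant

variable {X : Type*} [MeasurableSpace X] [AddAction G X] [MeasurableVAdd G X]
  {Y : Type*} [MeasurableSpace Y] [AddAction G Y] [MeasurableVAdd G Y]

/-- The process is full: the linear span of the products `ϑ₁(N(φ₁)) ⋯ ϑₙ(N(φₙ))` with
`ϑⱼ ∈ C_c(ℂ)` and `φⱼ ∈ C_c(G)` is dense in `L²(X, m)`. -/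
def IsFull (P : SpatialProcess G X) : Prop :=
  Dense (Submodule.span ℂ {f : Lp ℂ 2 P.m | ∃ (n : ℕ) (ϑ : Fin n → C_c(ℂ, ℂ))
    (φ : Fin n → C_c(G, ℂ)), 0 < n ∧ f =ᵐ[P.m] fun x => ∏ j, ϑ j (P.N (φ j) x)} :
    Set (Lp ℂ 2 P.m))

/-- The map `N` is positive: `N(φ) ≥ 0` almost everywhere whenever `φ ≥ 0`. -/
def IsPositive (P : SpatialProcess G X) : Prop :=
  ∀ φ : C_c(G, ℂ), 0 ≤ φ → ∀ᵐ x ∂P.m, 0 ≤ P.N φ x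

/-- Two spatial processes are spatially isomorphic if some unitary `U : L²(X, m) → L²(Y, m')`
intertwines the maps `N` and the Koopman operators and is multiplicative on essentially bounded
functions, together with its inverse. -/
def Equivalent (P : SpatialProcess G X) (Q : SpatialProcess G Y) : Prop :=
  ∃ U : Lp ℂ 2 P.m ≃ₗᵢ[ℂ] Lp ℂ 2 Q.m,
    (∀ φ : C_c(G, ℂ), U (P.N φ) = Q.N φ) ∧
    (∀ (t : G) (f : Lp ℂ 2 P.m), U (koopman P.m t f) = koopman Q.m t (U f)) ∧
    (∀ f g h : Lp ℂ 2 P.m, MemLp f ∞ P.m → MemLp g ∞ P.m → h =ᵐ[P.m] (fun x => f x * g x) →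
      U h =ᵐ[Q.m] fun y => U f y * U g y) ∧
    (∀ f g h : Lp ℂ 2 Q.m, MemLp f ∞ Q.m → MemLp g ∞ Q.m → h =ᵐ[Q.m] (fun y => f y * g y) →
      U.symm h =ᵐ[P.m] fun x => U.symm f x * U.symm g x)

end SpatialProcess

end SpatialProcesses

/-! ### Positive measure dynamical systems -/

/-- The space `𝓜⁺(G)` of positive measures on `G`: the continuous linear functionals `ν` on `C_c(G)`
with `ν(φ) ≥ 0` for all `φ ≥ 0`. -/
def PositiveMeasures (G : Type*) [TopologicalSpace G] : Type _ :=
  {ν : WeakDual ℂ C_c(G, ℂ) // ∀ φ : C_c(G, ℂ), 0 ≤ φ → 0 ≤ ν φ}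

namespace PositiveMeasures

section Topology

variable {G : Type*} [TopologicalSpace G]

/-- `𝓜⁺(G)` carries the vague topology, that is, the weak-* topology. -/
instance : TopologicalSpace (PositiveMeasures G) :=
  inferInstanceAs (TopologicalSpace
    {ν : WeakDual ℂ C_c(G, ℂ) // ∀ φ : C_c(G, ℂ), 0 ≤ φ → 0 ≤ ν φ})

/-- `𝓜⁺(G)` carries the Borel σ-algebra of the vague topology. -/
instance : MeasurableSpace (PositiveMeasures G) := borel _

instance : BorelSpace (PositiveMeasures G) := ⟨rfl⟩

/-- The evaluation `ν(φ) = ∫ φ dν`. -/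
noncomputable def eval (φ : C_c(G, ℂ)) (ν : PositiveMeasures G) : ℂ := ν.1 φ

theorem continuous_eval (φ : C_c(G, ℂ)) : Continuous (eval φ) :=
  (WeakDual.eval_continuous φ).comp continuous_subtype_val

theorem continuous_of_eval {Z : Type*} [TopologicalSpace Z] {f : Z → PositiveMeasures G}
    (h : ∀ φ : C_c(G, ℂ), Continuous (fun z => eval φ (f z))) : Continuous f :=
  Continuous.subtype_mk (WeakDual.continuous_of_continuous_eval h) (fun z => (f z).2)

theorem ext_eval {ν ν' : PositiveMeasures G} (h : ∀ φ, eval φ ν = eval φ ν') : ν = ν' :=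
  Subtype.ext (DFunLike.ext _ _ h)

end Topology

section Action

variable {G : Type*} [AddCommGroup G] [TopologicalSpace G] [IsTopologicalAddGroup G]

/-- The action of `G` on `𝓜⁺(G)` by translation, `(α_t ν)(φ) = ν(τ_{-t} φ)`. -/
noncomputable instance : AddAction G (PositiveMeasures G) where
  vadd t ν := ⟨ContinuousLinearMap.comp (ν.1 : C_c(G, ℂ) →L[ℂ] ℂ) (CcSpace.translate (-t)),
    fun φ hφ => ν.2 _ fun s => hφ (s - -t)⟩
  zero_vadd ν := ext_eval fun φ => by
    change ν.1 (CcSpace.translate (-0) φ) = ν.1 φ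
    congr 1
    ext s
    simp
  add_vadd t t' ν := ext_eval fun φ => by
    change ν.1 (CcSpace.translate (-(t + t')) φ) =
      ν.1 (CcSpace.translate (-t') (CcSpace.translate (-t) φ))
    congr 1
    ext s
    simp only [CcSpace.translate_apply]
    congr 1
    abel

theorem eval_vadd (φ : C_c(G, ℂ)) (t : G) (ν : PositiveMeasures G) :
    eval φ (t +ᵥ ν) = eval (CcSpace.translate (-t) φ) ν := rfl

instance [LocallyCompactSpace G] [MeasurableSpace G] [BorelSpace G] :
    MeasurableVAdd G (PositiveMeasures G) where
  measurable_const_vadd t :=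
    (continuous_of_eval fun φ => continuous_eval (CcSpace.translate (-t) φ)).measurable
  measurable_vadd_const ν :=
    (continuous_of_eval (f := fun t : G => t +ᵥ ν) fun φ =>
      ((map_continuous ν.1).comp (CcSpace.continuous_translateFun φ)).comp
        continuous_neg).measurable

end Action

section PMDS

variable {G : Type*} [TopologicalSpace G]

/-- A measure `m` on `𝓜⁺(G)` is square integrable: `∫ |ν(φ)|² dm(ν) < ∞` for all `φ ∈ C_c(G)`. -/
def SquareIntegrable (m : Measure (PositiveMeasures G)) : Prop :=
  ∀ φ : C_c(G, ℂ), ∫⁻ ν, ‖eval φ ν‖ₑ ^ 2 ∂m < ∞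

theorem SquareIntegrable.memLp {m : Measure (PositiveMeasures G)} (hm : SquareIntegrable m)
    (φ : C_c(G, ℂ)) : MemLp (eval φ) 2 m := by
  refine ⟨(continuous_eval φ).measurable.aestronglyMeasurable, ?_⟩
  rw [eLpNorm_lt_top_iff_lintegral_rpow_enorm_lt_top (by norm_num) (by norm_num)]
  simpa using hm φ

theorem eval_add (φ ψ : C_c(G, ℂ)) (ν : PositiveMeasures G) :
    eval (φ + ψ) ν = eval φ ν + eval ψ ν := map_add ν.1 φ ψ

theorem eval_sub (φ ψ : C_c(G, ℂ)) (ν : PositiveMeasures G) :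
    eval (φ - ψ) ν = eval φ ν - eval ψ ν := by
  have h := eval_add (φ - ψ) ψ ν
  rw [sub_add_cancel] at h
  rw [h, add_sub_cancel_right]

theorem eval_smul (c : ℂ) (φ : C_c(G, ℂ)) (ν : PositiveMeasures G) :
    eval (c • φ) ν = c * eval φ ν := map_smul ν.1 c φ

/-- The real part of `φ`. -/
noncomputable def rePart (φ : C_c(G, ℂ)) : C_c(G, ℂ) :=
  φ.compLeft ⟨fun z => (z.re : ℂ), by fun_prop⟩

theorem rePart_apply (φ : C_c(G, ℂ)) (s : G) : rePart φ s = ((φ s).re : ℂ) :=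
  CompactlySupportedContinuousMap.compLeft_apply (by simp) φ s

/-- The imaginary part of `φ`. -/
noncomputable def imPart (φ : C_c(G, ℂ)) : C_c(G, ℂ) :=
  φ.compLeft ⟨fun z => (z.im : ℂ), by fun_prop⟩

theorem imPart_apply (φ : C_c(G, ℂ)) (s : G) : imPart φ s = ((φ s).im : ℂ) :=
  CompactlySupportedContinuousMap.compLeft_apply (by simp) φ s

/-- The positive part of the real part of `φ`. -/
noncomputable def posPart (φ : C_c(G, ℂ)) : C_c(G, ℂ) :=
  φ.compLeft ⟨fun z => ((max z.re 0 : ℝ) : ℂ), by fun_prop⟩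

theorem posPart_apply (φ : C_c(G, ℂ)) (s : G) : posPart φ s = ((max (φ s).re 0 : ℝ) : ℂ) :=
  CompactlySupportedContinuousMap.compLeft_apply (by simp) φ s

theorem posPart_nonneg (φ : C_c(G, ℂ)) : 0 ≤ posPart φ := fun s => by
  change 0 ≤ posPart φ s
  rw [posPart_apply]
  exact Complex.zero_le_real.2 (le_max_right _ _)

theorem re_add_im_part (φ : C_c(G, ℂ)) : rePart φ + Complex.I • imPart φ = φ := by
  ext s
  simp only [CompactlySupportedContinuousMap.add_apply, CompactlySupportedContinuousMap.smul_apply,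
    rePart_apply, imPart_apply, smul_eq_mul]
  rw [mul_comm]
  exact Complex.re_add_im _

theorem pos_sub_neg_part (φ : C_c(G, ℂ)) : posPart φ - posPart (-φ) = rePart φ := by
  ext s
  simp only [CompactlySupportedContinuousMap.sub_apply, posPart_apply, rePart_apply,
    CompactlySupportedContinuousMap.neg_apply, Complex.neg_re]
  rw [← Complex.ofReal_sub]
  congr 1
  rcases le_total 0 (φ s).re with h | h
  · rw [max_eq_left h, max_eq_right (by linarith)]; ring
  · rw [max_eq_right h, max_eq_left (by linarith)]; ring

theorem eval_nonneg {φ : C_c(G, ℂ)} (hφ : 0 ≤ φ) (ν : PositiveMeasures G) : 0 ≤ eval φ ν :=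
  ν.2 φ hφ

theorem im_eval_rePart (φ : C_c(G, ℂ)) (ν : PositiveMeasures G) : (eval (rePart φ) ν).im = 0 := by
  rw [← pos_sub_neg_part, eval_sub, Complex.sub_im,
    ← (Complex.nonneg_iff.1 (eval_nonneg (posPart_nonneg φ) ν)).2,
    ← (Complex.nonneg_iff.1 (eval_nonneg (posPart_nonneg (-φ)) ν)).2, sub_zero]

theorem rePart_imPart (φ : C_c(G, ℂ)) : rePart (imPart φ) = imPart φ := by
  ext s
  simp [rePart_apply, imPart_apply]

theorem im_eval_imPart (φ : C_c(G, ℂ)) (ν : PositiveMeasures G) : (eval (imPart φ) ν).im = 0 := by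
  rw [← rePart_imPart]
  exact im_eval_rePart _ ν

theorem eval_star (φ : C_c(G, ℂ)) (ν : PositiveMeasures G) :
    eval (star φ) ν = star (eval φ ν) := by
  have h1 : rePart (star φ) = rePart φ := by
    ext s
    simp [rePart_apply]
  have h2 : imPart (star φ) = (-1 : ℂ) • imPart φ := by
    ext s
    simp [imPart_apply]
  rw [← re_add_im_part (star φ), h1, h2]
  conv_rhs => rw [← re_add_im_part φ]
  simp only [eval_add, eval_smul]
  have h3 := im_eval_rePart φ ν
  have h4 := im_eval_imPart φ ν
  apply Complex.ext <;> simp [h3, h4]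

/-- A real-valued function `φ` with `|φ| ≤ M χ` satisfies `|ν(φ)| ≤ M |ν(χ)|`. -/
theorem norm_eval_le_of_real {χ φ : C_c(G, ℂ)} {M : ℝ} (hφ : ∀ s, (φ s).im = 0)
    (hχ : 0 ≤ χ) (h : ∀ s, |(φ s).re| ≤ M * (χ s).re) (ν : PositiveMeasures G) :
    ‖eval φ ν‖ ≤ M * ‖eval χ ν‖ := by
  have him : ∀ s, (χ s).im = 0 := fun s => ((Complex.nonneg_iff.1 (hχ s)).2).symm
  have h1 : 0 ≤ (M : ℂ) • χ + φ := fun s => by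
    change 0 ≤ (M : ℂ) * χ s + φ s
    rw [Complex.nonneg_iff]
    have := neg_abs_le (φ s).re
    refine ⟨?_, by simp [hφ s, him s]⟩
    have := h s
    simp only [Complex.add_re, Complex.re_ofReal_mul]
    linarith
  have h2 : 0 ≤ (M : ℂ) • χ - φ := fun s => by
    change 0 ≤ (M : ℂ) * χ s - φ s
    rw [Complex.nonneg_iff]
    have := le_abs_self (φ s).re
    refine ⟨?_, by simp [hφ s, him s]⟩
    have := h s
    simp only [Complex.sub_re, Complex.re_ofReal_mul]
    linarith
  have h1' := Complex.nonneg_iff.1 (eval_nonneg h1 ν)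
  have h2' := Complex.nonneg_iff.1 (eval_nonneg h2 ν)
  have h3 := Complex.nonneg_iff.1 (eval_nonneg hχ ν)
  simp only [eval_add, eval_sub, eval_smul, Complex.add_re, Complex.sub_re, Complex.add_im,
    Complex.sub_im, Complex.re_ofReal_mul, Complex.im_ofReal_mul, ← h3.2, mul_zero] at h1' h2'
  have e1 : eval φ ν = ((eval φ ν).re : ℂ) := by
    apply Complex.ext
    · simp
    · simpa using h1'.2.symm
  have e2 : eval χ ν = ((eval χ ν).re : ℂ) := by
    apply Complex.ext
    · simp
    · simpa using h3.2.symm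
  rw [e1, e2, Complex.norm_real, Complex.norm_real, Real.norm_eq_abs, Real.norm_eq_abs,
    abs_of_nonneg h3.1, abs_le]
  constructor <;> linarith [h1'.1, h2'.1]

/-- A positive functional is bounded, for the supremum norm, on the functions supported in a set on
which `χ ≥ 1`. -/
theorem norm_eval_le {χ : C_c(G, ℂ)} {K : Set G} (hχ : 0 ≤ χ) (hχK : ∀ s ∈ K, 1 ≤ (χ s).re)
    {φ : C_c(G, ℂ)} (hφ : tsupport φ ⊆ K) (ν : PositiveMeasures G) :
    ‖eval φ ν‖ ≤ 2 * ‖CcSpace.toBCF φ‖ * ‖eval χ ν‖ := by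
  have key : ∀ s, ‖φ s‖ ≤ ‖CcSpace.toBCF φ‖ * (χ s).re := fun s => by
    by_cases hs : s ∈ K
    · have h1 : ‖φ s‖ ≤ ‖CcSpace.toBCF φ‖ := (CcSpace.toBCF φ).norm_coe_le_norm s
      nlinarith [hχK s hs, norm_nonneg (CcSpace.toBCF φ)]
    · have h0 : φ s = 0 := image_eq_zero_of_notMem_tsupport fun h => hs (hφ h)
      rw [h0, norm_zero]
      exact mul_nonneg (norm_nonneg _) (Complex.nonneg_iff.1 (hχ s)).1
  have h1 : ‖eval (rePart φ) ν‖ ≤ ‖CcSpace.toBCF φ‖ * ‖eval χ ν‖ :=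
    norm_eval_le_of_real (fun s => by simp [rePart_apply]) hχ
      (fun s => by
        simpa [rePart_apply] using (Complex.abs_re_le_norm (φ s)).trans (key s)) ν
  have h2 : ‖eval (imPart φ) ν‖ ≤ ‖CcSpace.toBCF φ‖ * ‖eval χ ν‖ :=
    norm_eval_le_of_real (fun s => by simp [imPart_apply]) hχ
      (fun s => by
        simpa [imPart_apply] using (Complex.abs_im_le_norm (φ s)).trans (key s)) ν
  calc ‖eval φ ν‖ = ‖eval (rePart φ) ν + Complex.I * eval (imPart φ) ν‖ := by
        rw [← eval_smul, ← eval_add, re_add_im_part]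
    _ ≤ ‖eval (rePart φ) ν‖ + ‖Complex.I * eval (imPart φ) ν‖ := norm_add_le _ _
    _ ≤ 2 * ‖CcSpace.toBCF φ‖ * ‖eval χ ν‖ := by
        rw [norm_mul, Complex.norm_I, one_mul]
        linarith

theorem exists_cutoff [LocallyCompactSpace G] [T2Space G] (K : TopologicalSpace.Compacts G) :
    ∃ χ : C_c(G, ℂ), 0 ≤ χ ∧ ∀ s ∈ (K : Set G), 1 ≤ (χ s).re := by
  obtain ⟨f, hf1, -, hfc, hf01⟩ :=
    exists_continuous_one_zero_of_isCompact K.isCompact isClosed_empty (Set.disjoint_empty _)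
  refine ⟨⟨⟨fun s => (f s : ℂ), by fun_prop⟩, hfc.comp_left Complex.ofReal_zero⟩, ?_, ?_⟩
  · intro s
    exact Complex.zero_le_real.2 (hf01 s).1
  · intro s hs
    have h := hf1 hs
    change 1 ≤ ((f s : ℂ)).re
    simp [h]

variable [AddCommGroup G] [IsTopologicalAddGroup G] [LocallyCompactSpace G] [T2Space G]
  [MeasurableSpace G] [BorelSpace G]

/-- The positive measure dynamical system given by a square integrable invariant probability measure
`m` on `𝓜⁺(G)`: the spatial process on `𝓜⁺(G)` with `N(φ)(ν) = ν(φ)`. -/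
noncomputable def process (m : Measure (PositiveMeasures G)) (hprob : IsProbabilityMeasure m)
    (hinv : VAddInvariantMeasure G (PositiveMeasures G) m) (hm : SquareIntegrable m) :
    SpatialProcess G (PositiveMeasures G) where
  m := m
  isProbabilityMeasure := hprob
  invariant := hinv
  N :=
    { toFun := fun φ => (hm.memLp φ).toLp (eval φ)
      map_add' := fun φ ψ => by
        rw [← MemLp.toLp_add]
        exact MemLp.toLp_congr _ _ (ae_of_all _ fun ν => map_add ν.1 φ ψ)
      map_smul' := fun c φ => by
        rw [RingHom.id_apply, ← MemLp.toLp_const_smul]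
        exact MemLp.toLp_congr _ _ (ae_of_all _ fun ν => map_smul ν.1 c φ)
      cont := by
        let f : C_c(G, ℂ) →ₗ[ℂ] Lp ℂ 2 m :=
          { toFun := fun φ => (hm.memLp φ).toLp (eval φ)
            map_add' := fun φ ψ => by
              rw [← MemLp.toLp_add]
              exact MemLp.toLp_congr _ _ (ae_of_all _ fun ν => map_add ν.1 φ ψ)
            map_smul' := fun c φ => by
              rw [RingHom.id_apply, ← MemLp.toLp_const_smul]
              exact MemLp.toLp_congr _ _ (ae_of_all _ fun ν => map_smul ν.1 c φ) }
        refine CcSpace.continuous_of_bound f fun K => ?_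
        obtain ⟨χ, hχ, hχK⟩ := exists_cutoff K
        refine ⟨2 * ‖f χ‖, fun φ hφ => ?_⟩
        have h : ‖f φ‖ ≤ (2 * ‖CcSpace.toBCF φ‖) * ‖f χ‖ := by
          refine Lp.norm_le_mul_norm_of_ae_le_mul ?_
          filter_upwards [(hm.memLp φ).coeFn_toLp, (hm.memLp χ).coeFn_toLp] with ν h1 h2
          change ‖((hm.memLp φ).toLp (eval φ)) ν‖ ≤ _ * ‖((hm.memLp χ).toLp (eval χ)) ν‖
          rw [h1, h2]
          exact norm_eval_le hχ hχK hφ ν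
        linarith }
  star_N φ := by
    change star ((hm.memLp φ).toLp (eval φ)) = (hm.memLp (star φ)).toLp (eval (star φ))
    apply Lp.ext
    filter_upwards [Lp.coeFn_star ((hm.memLp φ).toLp (eval φ)), (hm.memLp φ).coeFn_toLp,
      (hm.memLp (star φ)).coeFn_toLp] with ν h1 h2 h3
    rw [h1, h3, Pi.star_apply, h2, eval_star]
  koopman_N t φ := by
    change Lp.compMeasurePreserving (fun ν : PositiveMeasures G => -t +ᵥ ν)
      (measurePreserving_vadd (-t) m) ((hm.memLp φ).toLp (eval φ)) =
        (hm.memLp (CcSpace.translate t φ)).toLp (eval (CcSpace.translate t φ))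
    rw [Lp.toLp_compMeasurePreserving]
    refine MemLp.toLp_congr _ _ (ae_of_all _ fun ν => ?_)
    rw [Function.comp_apply, eval_vadd, neg_neg]

end PMDS

end PositiveMeasures

/-!
A positive process `N` is, for almost every point `x`, evaluation `φ ↦ N(φ)(x)` against a positive
measure `Φ(x)` on `G`. The only obstruction is that `N(φ)` is defined up to a null set depending on
`φ`. Since `G` is second countable, there are an exhaustion of `G` by compact sets and a countable
set `D` of test functions which is uniformly dense, with control of supports and of positivity
(`CcSpace.IsApproximating`). If `χ ≥ 1` on `K`, positivity gives
`|N(φ)(x)| ≤ 2 ‖φ‖ |N(χ)(x)|` for almost every `x`, for each `φ` supported in `K`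
(`SpatialProcess.IsPositive.norm_le`). Outside one null set, these bounds therefore hold for all the
countably many approximate linear relations within `D`, and then `d ↦ N(d)(x)` extends from `D` to a
positive measure by uniform limits (`CcSpace.IsApproximating.exists_positiveMeasure`).

The vague topology is the initial topology of the evaluations at elements of `D`, so that the vague
Borel `σ`-algebra is generated by countably many evaluations. This makes `Φ` measurable
(`SpatialProcess.IsPositive.exists_measurable_map`) and almost everywhere equivariant. The measure
on `𝓜⁺(G)` is the image of `m` under `Φ`. Composition with `Φ` is an isometry into `L²(X, m)` whose
closed range contains the products `ϑ₁(N(φ₁)) ⋯ ϑₙ(N(φₙ))`; as the process is full, it is onto, and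
its inverse is the spatial isomorphism (`SpatialProcess.IsFull.equivalent_of_factorMap`).
-/

/-! ### Countable approximating families in `C_c(G)` -/

namespace CcSpace

variable {G : Type*} [TopologicalSpace G]

theorem norm_apply_le (φ : C_c(G, ℂ)) (s : G) : ‖φ s‖ ≤ ‖toBCF φ‖ :=
  (toBCF φ).norm_coe_le_norm s

theorem norm_toBCF_le {φ : C_c(G, ℂ)} {M : ℝ} (hM : 0 ≤ M) (h : ∀ s, ‖φ s‖ ≤ M) :
    ‖toBCF φ‖ ≤ M :=
  (BoundedContinuousFunction.norm_le hM).2 h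

theorem toBCF_add (φ ψ : C_c(G, ℂ)) : toBCF (φ + ψ) = toBCF φ + toBCF ψ := rfl

theorem toBCF_sub (φ ψ : C_c(G, ℂ)) : toBCF (φ - ψ) = toBCF φ - toBCF ψ := rfl

theorem toBCF_smul (a : ℂ) (φ : C_c(G, ℂ)) : toBCF (a • φ) = a • toBCF φ := rfl

theorem tsupport_add_subset {K : Set G} {φ ψ : C_c(G, ℂ)} (hφ : tsupport φ ⊆ K)
    (hψ : tsupport ψ ⊆ K) : tsupport (φ + ψ : C_c(G, ℂ)) ⊆ K :=
  (tsupport_add φ ψ).trans (Set.union_subset hφ hψ)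

theorem tsupport_smul_subset {K : Set G} (a : ℂ) {φ : C_c(G, ℂ)} (hφ : tsupport φ ⊆ K) :
    tsupport (a • φ : C_c(G, ℂ)) ⊆ K :=
  (tsupport_smul_subset_right (fun _ => a) φ).trans hφ

/-- `D` is a countable set of test functions and `K` an increasing sequence of compact sets such
that every compact set lies in some `K k`, and every (nonnegative) test function supported in `K k`
is a uniform limit of (nonnegative) elements of `D` supported in the same `K k`. -/
structure IsApproximating (D : Set C_c(G, ℂ)) (K : ℕ → TopologicalSpace.Compacts G) : Prop where
  countable : D.Countable
  mono : Monotone K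
  exhaust : ∀ C : Set G, IsCompact C → ∃ k, C ⊆ (K k : Set G)
  approx : ∀ (k : ℕ) (φ : C_c(G, ℂ)), tsupport φ ⊆ (K k : Set G) → ∀ ε > 0, ∃ d ∈ D,
    tsupport d ⊆ (K k : Set G) ∧ ‖toBCF (d - φ)‖ ≤ ε ∧ (0 ≤ φ → 0 ≤ d)

/-- `C_K(G)` is separable, because restriction to `K` embeds it isometrically in `C(K, ℂ)`. -/
theorem exists_countable_dense_supportedIn [T2Space G] [SecondCountableTopology G]
    (K : TopologicalSpace.Compacts G) :
    ∃ D : Set C_c(G, ℂ), D.Countable ∧ ∀ φ : C_c(G, ℂ), tsupport φ ⊆ (K : Set G) → ∀ ε > 0,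
      ∃ d ∈ D, tsupport d ⊆ (K : Set G) ∧ ‖toBCF (d - φ)‖ ≤ ε := by
  have : CompactSpace (K : Set G) := isCompact_iff_compactSpace.1 K.isCompact
  let r : C_c(G, ℂ) → C((K : Set G), ℂ) := fun φ => φ.toContinuousMap.restrict K
  obtain ⟨t, hts, htc, hst⟩ := (TopologicalSpace.IsSeparable.of_separableSpace
    (r '' {φ | tsupport φ ⊆ (K : Set G)})).exists_countable_dense_subset
  choose g hg hgr using fun y : t => hts y.2
  refine ⟨Set.range g, ?_, fun φ hφ ε hε => ?_⟩
  · have := htc.to_subtype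
    exact Set.countable_range g
  obtain ⟨y', hyt, hy⟩ := Metric.mem_closure_iff.1 (hst ⟨φ, hφ, rfl⟩) ε hε
  let y : t := ⟨y', hyt⟩
  refine ⟨g y, ⟨y, rfl⟩, hg y, norm_toBCF_le hε.le fun s => ?_⟩
  rw [CompactlySupportedContinuousMap.sub_apply]
  by_cases hs : s ∈ (K : Set G)
  · have h1 := (ContinuousMap.dist_apply_le_dist (f := r φ) (g := y') ⟨s, hs⟩).trans hy.le
    rw [show y' = r (g y) from (hgr y).symm, dist_comm, dist_eq_norm] at h1
    exact h1
  · rw [image_eq_zero_of_notMem_tsupport fun h => hs (hφ h),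
      image_eq_zero_of_notMem_tsupport fun h => hs (hg y h)]
    simpa using hε.le

theorem tsupport_posPart_subset (φ : C_c(G, ℂ)) :
    tsupport (PositiveMeasures.posPart φ) ⊆ tsupport φ := by
  refine closure_mono fun s hs => ?_
  rw [Function.mem_support, PositiveMeasures.posPart_apply] at hs
  exact fun h => hs (by simp [h])

theorem norm_toBCF_posPart_sub_le {φ : C_c(G, ℂ)} (hφ : 0 ≤ φ) (d : C_c(G, ℂ)) :
    ‖toBCF (PositiveMeasures.posPart d - φ)‖ ≤ ‖toBCF (d - φ)‖ := by
  refine norm_toBCF_le (norm_nonneg _) fun s => le_trans ?_ (norm_apply_le (d - φ) s)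
  have h := Complex.nonneg_iff.1 (hφ s)
  have e : φ s = ((max (φ s).re 0 : ℝ) : ℂ) := by
    rw [max_eq_left h.1]
    exact Complex.ext (by simp) (by simpa using h.2.symm)
  rw [CompactlySupportedContinuousMap.sub_apply, CompactlySupportedContinuousMap.sub_apply,
    PositiveMeasures.posPart_apply]
  refine le_trans ?_ (Complex.abs_re_le_norm _)
  rw [e, ← Complex.ofReal_sub, Complex.norm_real, Real.norm_eq_abs, ← e, Complex.sub_re]
  exact abs_max_sub_max_le_abs _ _ _

theorem exists_isApproximating [LocallyCompactSpace G] [T2Space G] [SecondCountableTopology G] :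
    ∃ (D : Set C_c(G, ℂ)) (K : ℕ → TopologicalSpace.Compacts G), IsApproximating D K := by
  let E : CompactExhaustion G := default
  let K : ℕ → TopologicalSpace.Compacts G := fun k => ⟨E k, E.isCompact k⟩
  choose D hDc hD using fun k => exists_countable_dense_supportedIn (K k)
  refine ⟨⋃ k, (D k ∪ PositiveMeasures.posPart '' D k), K,
    Set.countable_iUnion fun k => (hDc k).union ((hDc k).image _), fun i j hij => E.subset hij,
    fun C hC => E.exists_superset_of_isCompact hC,
    fun k φ hφ ε hε => ?_⟩
  obtain ⟨d, hd, hdK, hdφ⟩ := hD k φ hφ ε hε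
  by_cases h0 : 0 ≤ φ
  · exact ⟨PositiveMeasures.posPart d, Set.mem_iUnion.2 ⟨k, .inr ⟨d, hd, rfl⟩⟩,
      (tsupport_posPart_subset d).trans hdK, (norm_toBCF_posPart_sub_le h0 d).trans hdφ,
      fun _ => PositiveMeasures.posPart_nonneg d⟩
  · exact ⟨d, Set.mem_iUnion.2 ⟨k, .inl hd⟩, hdK, hdφ, fun h => absurd h h0⟩

/-! ### Extending a functional from an approximating family -/

/-- A function on an approximating family `D` extends to a positive measure if it is nonnegative on
nonnegative elements, and linear up to an error controlled by the supremum norm. Since `D` is not a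
subspace, this approximate linearity, with scalars from a dense set, replaces linearity and
continuity at once. -/
theorem IsApproximating.exists_positiveMeasure {D : Set C_c(G, ℂ)}
    {K : ℕ → TopologicalSpace.Compacts G} (h : IsApproximating D K) {A : Set ℂ} (hA : Dense A)
    (h0 : 0 ∈ A) {c : ℕ → ℝ} (hc : ∀ k, 0 ≤ c k) {n : C_c(G, ℂ) → ℂ}
    (hn : ∀ k, ∀ a ∈ A, ∀ d₁ ∈ D, ∀ d₂ ∈ D, ∀ d₃ ∈ D,
      tsupport (d₁ - (a • d₂ + d₃) : C_c(G, ℂ)) ⊆ (K k : Set G) →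
        ‖n d₁ - (a * n d₂ + n d₃)‖ ≤ ‖toBCF (d₁ - (a • d₂ + d₃))‖ * c k)
    (hp : ∀ d ∈ D, 0 ≤ d → 0 ≤ n d) :
    ∃ ν : PositiveMeasures G, ∀ d ∈ D, PositiveMeasures.eval d ν = n d := by
  -- The scalar `0` turns approximate linearity into a Lipschitz bound on each `C_K(G)`.
  have hdiff : ∀ k, ∀ d ∈ D, ∀ e ∈ D, tsupport d ⊆ (K k : Set G) → tsupport e ⊆ (K k : Set G) →
      ‖n d - n e‖ ≤ ‖toBCF (d - e)‖ * c k := by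
    intro k d hd e he hdK heK
    simpa using hn k 0 h0 d hd d hd e he (by simpa using tsupport_sub_subset hdK heK)
  -- With the least index for `φ`, the approximants `u φ j` are supported in every `K k` that
  -- contains the support of `φ`; hence the limit is bounded on `C_K(G)` by a constant that
  -- depends only on `K`.
  have hmin : ∀ φ : C_c(G, ℂ), ∃ k, tsupport φ ⊆ (K k : Set G) ∧
      ∀ j, tsupport φ ⊆ (K j : Set G) → k ≤ j := by
    classical
    intro φ
    have hφ := h.exhaust _ φ.hasCompactSupport.isCompact
    exact ⟨Nat.find hφ, Nat.find_spec hφ, fun j hj => Nat.find_min' hφ hj⟩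
  choose κ hκ hκ' using hmin
  choose u huD huK hu hu0 using fun (φ : C_c(G, ℂ)) (j : ℕ) =>
    h.approx (κ φ) φ (hκ φ) (1 / ((j : ℝ) + 1)) (by positivity)
  have huK' : ∀ (φ : C_c(G, ℂ)) k j, tsupport φ ⊆ (K k : Set G) →
      tsupport (u φ j) ⊆ (K k : Set G) :=
    fun φ k j hk => (huK φ j).trans (h.mono (hκ' φ k hk))
  have hulim : ∀ φ, Tendsto (fun j => toBCF (u φ j)) atTop (𝓝 (toBCF φ)) := fun φ => by
    rw [tendsto_iff_norm_sub_tendsto_zero]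
    exact squeeze_zero (fun _ => norm_nonneg _) (fun j => hu φ j)
      tendsto_one_div_add_atTop_nhds_zero_nat
  have hcauchy : ∀ φ, CauchySeq fun j => n (u φ j) := fun φ => by
    refine cauchySeq_of_le_tendsto_0 (fun N : ℕ => 2 * (1 / ((N : ℝ) + 1)) * c (κ φ)) ?_ ?_
    · intro i j N hi hj
      rw [dist_eq_norm]
      refine (hdiff (κ φ) _ (huD φ i) _ (huD φ j) (huK φ i) (huK φ j)).trans
        (mul_le_mul_of_nonneg_right ?_ (hc _))
      have e : toBCF (u φ i - u φ j) = toBCF (u φ i - φ) - toBCF (u φ j - φ) := by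
        simp only [toBCF_sub]; abel
      rw [e]
      refine (norm_sub_le _ _).trans ?_
      have hi' := (hu φ i).trans (Nat.one_div_le_one_div hi)
      have hj' := (hu φ j).trans (Nat.one_div_le_one_div hj)
      linarith
    · simpa using ((tendsto_one_div_add_atTop_nhds_zero_nat (𝕜 := ℝ)).const_mul 2).mul_const
        (c (κ φ))
  choose L hL using fun φ => cauchySeq_tendsto_of_complete (hcauchy φ)
  have hlin : ∀ (a : ℂ) (φ ψ : C_c(G, ℂ)), L (a • φ + ψ) = a * L φ + L ψ := by
    intro a φ ψ
    obtain ⟨α, hαA, hα⟩ := mem_closure_iff_seq_limit.1 (hA a)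
    obtain ⟨k, hkφ, hkψ⟩ : ∃ k, tsupport φ ⊆ (K k : Set G) ∧ tsupport ψ ⊆ (K k : Set G) :=
      ⟨max (κ φ) (κ ψ), (hκ φ).trans (h.mono (le_max_left _ _)),
        (hκ ψ).trans (h.mono (le_max_right _ _))⟩
    have hk := tsupport_add_subset (tsupport_smul_subset a hkφ) hkψ
    have h1 : Tendsto (fun j => ‖toBCF (u (a • φ + ψ) j - (α j • u φ j + u ψ j))‖ * c k) atTop
        (𝓝 0) := by
      have := (((hulim (a • φ + ψ)).sub ((hα.smul (hulim φ)).add (hulim ψ))).norm).mul_const (c k)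
      simpa [toBCF_sub, toBCF_add, toBCF_smul] using this
    have h2 := squeeze_zero_norm (fun j => hn k (α j) (hαA j) _ (huD (a • φ + ψ) j) _ (huD φ j) _
      (huD ψ j) (tsupport_sub_subset (huK' _ k j hk) (tsupport_add_subset
        (tsupport_smul_subset _ (huK' _ k j hkφ)) (huK' _ k j hkψ)))) h1
    exact sub_eq_zero.1 (tendsto_nhds_unique
      ((hL (a • φ + ψ)).sub ((hα.mul (hL φ)).add (hL ψ))) h2)
  have hzero : L 0 = 0 := by simpa using hlin 1 0 0
  let f : C_c(G, ℂ) →ₗ[ℂ] ℂ :=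
    { toFun := L
      map_add' := fun φ ψ => by simpa using hlin 1 φ ψ
      map_smul' := fun a φ => by simpa [hzero] using hlin a φ 0 }
  have hbound : ∀ k (φ : C_c(G, ℂ)), tsupport φ ⊆ (K k : Set G) → ‖L φ‖ ≤ c k * ‖toBCF φ‖ := by
    intro k φ hφ
    have h0K : tsupport (0 : C_c(G, ℂ)) ⊆ (K k : Set G) := by
      simp
    have h1 := ((hL φ).sub (hL 0)).norm
    have h2 : Tendsto (fun j => ‖toBCF (u φ j - u 0 j)‖ * c k) atTop
        (𝓝 (‖toBCF φ - toBCF 0‖ * c k)) :=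
      (((hulim φ).sub (hulim 0)).norm).mul_const (c k)
    have h3 := le_of_tendsto_of_tendsto' h1 h2 fun j => hdiff k _ (huD φ j) _ (huD 0 j)
      (huK' _ k j hφ) (huK' _ k j h0K)
    rw [hzero, sub_zero, ← toBCF_sub, sub_zero] at h3
    linarith
  have hcont : Continuous f := by
    refine continuous_of_bound f fun C => ?_
    obtain ⟨k, hk⟩ := h.exhaust C C.isCompact
    exact ⟨c k, fun φ hφ => hbound k φ (hφ.trans hk)⟩
  refine ⟨⟨⟨f, hcont⟩, fun φ hφ => ge_of_tendsto' (hL φ) fun j => hp _ (huD φ j) (hu0 φ j hφ)⟩,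
    fun d hd => ?_⟩
  have h1 : Tendsto (fun j => ‖toBCF (u d j - d)‖ * c (κ d)) atTop (𝓝 0) := by
    have := (((hulim d).sub_const (toBCF d)).norm).mul_const (c (κ d))
    simpa [toBCF_sub] using this
  have h2 := squeeze_zero_norm (fun j => hdiff (κ d) _ (huD d j) _ hd (huK d j) (hκ d)) h1
  exact sub_eq_zero.1 (tendsto_nhds_unique ((hL d).sub_const (n d)) h2)

end CcSpace

/-! ### The vague topology is determined by an approximating family -/

namespace CcSpace.IsApproximating

open PositiveMeasures

variable {G : Type*} [TopologicalSpace G] [LocallyCompactSpace G] [T2Space G]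
  {D : Set C_c(G, ℂ)} {K : ℕ → TopologicalSpace.Compacts G}

/-- An approximating family contains functions that dominate `1` on a given compact set: it contains
functions at distance at most `1` from twice a cutoff function. -/
theorem exists_cutoff_mem (h : IsApproximating D K) (k : ℕ) :
    ∃ χ ∈ D, 0 ≤ χ ∧ ∀ s ∈ (K k : Set G), 1 ≤ (χ s).re := by
  obtain ⟨χ, hχ, hχK⟩ := exists_cutoff (K k)
  obtain ⟨j, hj⟩ := h.exhaust _ ((2 : ℂ) • χ).hasCompactSupport.isCompact
  obtain ⟨d, hd, -, hdχ, hd0⟩ := h.approx j _ hj 1 one_pos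
  refine ⟨d, hd, hd0 fun s => mul_nonneg zero_le_two (hχ s), fun s hs => ?_⟩
  have h1 := (Complex.abs_re_le_norm _).trans ((norm_apply_le (d - (2 : ℂ) • χ) s).trans hdχ)
  have h2 := (abs_le.1 h1).1
  have h3 := hχK s hs
  simp only [CompactlySupportedContinuousMap.sub_apply, CompactlySupportedContinuousMap.smul_apply,
    smul_eq_mul, Complex.sub_re, Complex.mul_re, Complex.re_ofNat, Complex.im_ofNat] at h2
  linarith

theorem continuous_of_eval_mem (h : IsApproximating D K) {Z : Type*} [TopologicalSpace Z]
    {f : Z → PositiveMeasures G} (hf : ∀ d ∈ D, Continuous fun z => eval d (f z)) :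
    Continuous f := by
  refine continuous_of_eval fun φ => continuous_iff_continuousAt.2 fun z =>
    continuousAt_of_locally_uniform_approx_of_continuousAt fun u hu => ?_
  obtain ⟨ε, hε, hεu⟩ := Metric.mem_uniformity_dist.1 hu
  obtain ⟨k, hk⟩ := h.exhaust _ φ.hasCompactSupport.isCompact
  obtain ⟨χ, hχD, hχ, hχK⟩ := h.exists_cutoff_mem k
  set M : ℝ := ‖eval χ (f z)‖ + 1
  have hM0 : 0 < M := by positivity
  obtain ⟨d, hd, hdK, hdφ, -⟩ := h.approx k φ hk (ε / (4 * M)) (by positivity)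
  refine ⟨{y | ‖eval χ (f y)‖ < M}, (hf χ hχD).norm.continuousAt.eventually_lt_const
    (lt_add_one _), fun y => eval d (f y), (hf d hd).continuousAt, fun y hy => hεu ?_⟩
  rw [dist_comm, dist_eq_norm, ← eval_sub]
  calc ‖eval (d - φ) (f y)‖ ≤ 2 * ‖toBCF (d - φ)‖ * ‖eval χ (f y)‖ :=
        norm_eval_le hχ hχK (tsupport_sub_subset hdK hk) _
    _ ≤ 2 * (ε / (4 * M)) * M := by
        have : ‖eval χ (f y)‖ ≤ M := le_of_lt hy
        gcongr
    _ = ε / 2 := by field_simp; norm_num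
    _ < ε := half_lt_self hε

theorem isInducing_eval (h : IsApproximating D K) :
    IsInducing fun (ν : PositiveMeasures G) (d : D) => eval d.1 ν := by
  refine ⟨le_antisymm (continuous_iff_le_induced.1 (continuous_pi fun d => continuous_eval d.1)) ?_⟩
  refine continuous_id_iff_le.1 ?_
  let _ : TopologicalSpace (PositiveMeasures G) := TopologicalSpace.induced
    (fun (ν : PositiveMeasures G) (d : D) => eval d.1 ν) inferInstance
  have hc : Continuous fun (ν : PositiveMeasures G) (d : D) => eval d.1 ν := continuous_induced_dom
  exact h.continuous_of_eval_mem fun d hd => (continuous_apply (⟨d, hd⟩ : D)).comp hc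

theorem measurable_of_eval_mem (h : IsApproximating D K) {Z : Type*} [MeasurableSpace Z]
    {f : Z → PositiveMeasures G} (hf : ∀ d ∈ D, Measurable fun z => eval d (f z)) :
    Measurable f := by
  have := h.countable.to_subtype
  have hm : Measurable fun (z : Z) (d : D) => eval d.1 (f z) :=
    measurable_pi_lambda _ fun d => hf d.1 d.2
  refine measurable_of_isOpen fun U hU => ?_
  obtain ⟨V, hV, rfl⟩ := h.isInducing_eval.isOpen_iff.1 hU
  exact hm hV.measurableSet

theorem ext_eval_mem (h : IsApproximating D K) {ν ν' : PositiveMeasures G}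
    (hν : ∀ d ∈ D, eval d ν = eval d ν') : ν = ν' :=
  have hs : Inseparable ν ν' := h.isInducing_eval.inseparable_iff.1
    (Inseparable.of_eq (funext fun d : D => hν d.1 d.2))
  ext_eval fun φ => (hs.map (continuous_eval φ)).eq

end CcSpace.IsApproximating

/-! ### The evaluation map of a positive process -/

namespace SpatialProcess

open PositiveMeasures CcSpace

variable {G : Type*} [AddCommGroup G] [MeasurableSpace G] [TopologicalSpace G]
  [IsTopologicalAddGroup G]
  {X : Type*} [MeasurableSpace X] [AddAction G X] [MeasurableVAdd G X]
  {Y : Type*} [MeasurableSpace Y] [AddAction G Y] [MeasurableVAdd G Y]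

theorem coeFn_N_add (P : SpatialProcess G X) (φ ψ : C_c(G, ℂ)) :
    P.N (φ + ψ) =ᵐ[P.m] fun x => P.N φ x + P.N ψ x := by
  rw [map_add]
  exact Lp.coeFn_add _ _

theorem coeFn_N_sub (P : SpatialProcess G X) (φ ψ : C_c(G, ℂ)) :
    P.N (φ - ψ) =ᵐ[P.m] fun x => P.N φ x - P.N ψ x := by
  rw [map_sub]
  exact Lp.coeFn_sub _ _

theorem coeFn_N_smul (P : SpatialProcess G X) (a : ℂ) (φ : C_c(G, ℂ)) :
    P.N (a • φ) =ᵐ[P.m] fun x => a * P.N φ x := by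
  rw [map_smul]
  exact Lp.coeFn_smul _ _

theorem coeFn_koopman (P : SpatialProcess G X) (t : G) (f : Lp ℂ 2 P.m) :
    koopman P.m t f =ᵐ[P.m] fun x => f (-t +ᵥ x) :=
  Lp.coeFn_compMeasurePreserving f (measurePreserving_vadd (-t) P.m)

/-- For real-valued `φ`, a pointwise bound `|φ| ≤ M χ` passes through a positive process. -/
theorem IsPositive.norm_le_of_real {P : SpatialProcess G X} (hP : P.IsPositive)
    {χ φ : C_c(G, ℂ)} {M : ℝ} (hM : 0 ≤ M) (hφ : ∀ s, (φ s).im = 0) (hχ : 0 ≤ χ)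
    (h : ∀ s, |(φ s).re| ≤ M * (χ s).re) : ∀ᵐ x ∂P.m, ‖P.N φ x‖ ≤ M * ‖P.N χ x‖ := by
  have him : ∀ s, (χ s).im = 0 := fun s => ((Complex.nonneg_iff.1 (hχ s)).2).symm
  have h1 : 0 ≤ (M : ℂ) • χ + φ := fun s => by
    change 0 ≤ (M : ℂ) * χ s + φ s
    refine Complex.nonneg_iff.2 ⟨?_, by simp [hφ s, him s]⟩
    rw [Complex.add_re, Complex.re_ofReal_mul]
    linarith [neg_abs_le (φ s).re, h s]
  have h2 : 0 ≤ (M : ℂ) • χ - φ := fun s => by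
    change 0 ≤ (M : ℂ) * χ s - φ s
    refine Complex.nonneg_iff.2 ⟨?_, by simp [hφ s, him s]⟩
    rw [Complex.sub_re, Complex.re_ofReal_mul]
    linarith [le_abs_self (φ s).re, h s]
  filter_upwards [hP _ h1, hP _ h2, P.coeFn_N_add ((M : ℂ) • χ) φ, P.coeFn_N_sub ((M : ℂ) • χ) φ,
    P.coeFn_N_smul M χ] with x p1 p2 e1 e2 e3
  rw [e1, e3, Complex.nonneg_iff] at p1
  rw [e2, e3, Complex.nonneg_iff] at p2
  simp only [Complex.add_re, Complex.sub_re, Complex.add_im, Complex.sub_im, Complex.re_ofReal_mul,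
    Complex.im_ofReal_mul] at p1 p2
  have e : P.N φ x = ((P.N φ x).re : ℂ) :=
    Complex.ext (by simp) (by rw [Complex.ofReal_im]; linarith [p1.2, p2.2])
  rw [e, Complex.norm_real, Real.norm_eq_abs]
  refine (abs_le.2 ⟨?_, ?_⟩).trans
    (mul_le_mul_of_nonneg_left (Complex.re_le_norm (P.N χ x)) hM) <;> linarith [p1.1, p2.1]

/-- A positive process is bounded pointwise, for the supremum norm, on the functions supported in a
set on which `χ ≥ 1`. -/
theorem IsPositive.norm_le {P : SpatialProcess G X} (hP : P.IsPositive) {χ : C_c(G, ℂ)} {K : Set G}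
    (hχ : 0 ≤ χ) (hχK : ∀ s ∈ K, 1 ≤ (χ s).re) {φ : C_c(G, ℂ)} (hφ : tsupport φ ⊆ K) :
    ∀ᵐ x ∂P.m, ‖P.N φ x‖ ≤ ‖toBCF φ‖ * (2 * ‖P.N χ x‖) := by
  have key : ∀ s, ‖φ s‖ ≤ ‖toBCF φ‖ * (χ s).re := fun s => by
    by_cases hs : s ∈ K
    · exact (norm_apply_le φ s).trans (le_mul_of_one_le_right (norm_nonneg _) (hχK s hs))
    · rw [image_eq_zero_of_notMem_tsupport fun h => hs (hφ h), norm_zero]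
      exact mul_nonneg (norm_nonneg _) (Complex.nonneg_iff.1 (hχ s)).1
  have h1 := hP.norm_le_of_real (φ := rePart φ) (norm_nonneg (toBCF φ))
    (fun s => by simp [rePart_apply]) hχ
    (fun s => by simpa [rePart_apply] using (Complex.abs_re_le_norm (φ s)).trans (key s))
  have h2 := hP.norm_le_of_real (φ := imPart φ) (norm_nonneg (toBCF φ))
    (fun s => by simp [imPart_apply]) hχ
    (fun s => by simpa [imPart_apply] using (Complex.abs_im_le_norm (φ s)).trans (key s))
  filter_upwards [h1, h2, P.coeFn_N_add (rePart φ) (Complex.I • imPart φ),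
    P.coeFn_N_smul Complex.I (imPart φ)] with x p1 p2 e1 e2
  rw [re_add_im_part] at e1
  rw [e1, e2]
  refine (norm_add_le _ _).trans ?_
  rw [norm_mul, Complex.norm_I, one_mul]
  linarith

/-- A positive process is given by evaluation along a measurable map into the positive measures. For
almost every `x`, the function `d ↦ N(d)(x)` on a countable approximating family satisfies countably
many conditions which make it extend to a positive measure; the extension is determined, with
measurable dependence on `x`, by its values on the family. -/
theorem IsPositive.exists_measurable_map [LocallyCompactSpace G] [T2Space G]
    [SecondCountableTopology G] {P : SpatialProcess G X} (hP : P.IsPositive) :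
    ∃ Φ : X → PositiveMeasures G, Measurable Φ ∧
      ∀ φ : C_c(G, ℂ), (fun x => eval φ (Φ x)) =ᵐ[P.m] P.N φ := by
  obtain ⟨D, K, h⟩ := exists_isApproximating (G := G)
  -- Scalars are approximated as well, so that only countably many relations have to hold.
  obtain ⟨B, hBc, hB⟩ := TopologicalSpace.exists_countable_dense ℂ
  let A : Set ℂ := insert 0 B
  have hAc : A.Countable := hBc.insert 0
  choose χ hχD hχ hχK using h.exists_cutoff_mem
  have hlin : ∀ᵐ x ∂P.m, ∀ k, ∀ a ∈ A, ∀ d₁ ∈ D, ∀ d₂ ∈ D, ∀ d₃ ∈ D,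
      tsupport (d₁ - (a • d₂ + d₃) : C_c(G, ℂ)) ⊆ (K k : Set G) →
        ‖P.N d₁ x - (a * P.N d₂ x + P.N d₃ x)‖ ≤
          ‖toBCF (d₁ - (a • d₂ + d₃))‖ * (2 * ‖P.N (χ k) x‖) := by
    refine ae_all_iff.2 fun k => (ae_ball_iff hAc).2 fun a _ => (ae_ball_iff h.countable).2
      fun d₁ _ => (ae_ball_iff h.countable).2 fun d₂ _ => (ae_ball_iff h.countable).2 fun d₃ _ =>
      eventually_imp_distrib_left.2 fun hs => ?_
    filter_upwards [hP.norm_le (hχ k) (hχK k) hs, P.coeFn_N_sub d₁ (a • d₂ + d₃),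
      P.coeFn_N_add (a • d₂) d₃, P.coeFn_N_smul a d₂] with x h1 e1 e2 e3
    rwa [e1, e2, e3] at h1
  have hpos : ∀ᵐ x ∂P.m, ∀ d ∈ D, 0 ≤ d → 0 ≤ P.N d x :=
    (ae_ball_iff h.countable).2 fun d _ => eventually_imp_distrib_left.2 (hP d)
  have hext : ∀ᵐ x ∂P.m, ∃ ν : PositiveMeasures G, ∀ d ∈ D, eval d ν = P.N d x := by
    filter_upwards [hlin, hpos] with x h1 h2
    exact h.exists_positiveMeasure (hB.mono (Set.subset_insert 0 B)) (Set.mem_insert 0 B)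
      (fun k => by positivity) h1 h2
  obtain ⟨S, hSsub, hS, hS1⟩ : ∃ S ⊆ {x | ∃ ν : PositiveMeasures G, ∀ d ∈ D, eval d ν = P.N d x},
      MeasurableSet S ∧ ∀ᵐ x ∂P.m, x ∈ S := by
    obtain ⟨T, hT, hTm, hT0⟩ := exists_measurable_superset_of_null (ae_iff.1 hext)
    exact ⟨Tᶜ, fun x hx => not_not.1 fun h => hx (hT h), hTm.compl,
      measure_eq_zero_iff_ae_notMem.1 hT0⟩
  -- Off the measurable conull set `S`, the zero measure serves.
  have hind : ∀ x, ∃ ν : PositiveMeasures G, ∀ d ∈ D, eval d ν = S.indicator (P.N d) x := by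
    intro x
    by_cases hx : x ∈ S
    · simp only [Set.indicator_of_mem hx]
      exact hSsub hx
    · simp only [Set.indicator_of_notMem hx]
      exact ⟨⟨0, fun φ _ => le_rfl⟩, fun d _ => rfl⟩
  choose Φ hΦ using hind
  refine ⟨Φ, h.measurable_of_eval_mem fun d hd => ?_, fun φ => ?_⟩
  · simp only [hΦ _ d hd]
    exact (Lp.stronglyMeasurable (P.N d)).measurable.indicator hS
  · obtain ⟨k, hk⟩ := h.exhaust _ φ.hasCompactSupport.isCompact
    have hφ : ∀ᵐ x ∂P.m, ∀ d ∈ D, tsupport d ⊆ (K k : Set G) →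
        ‖P.N d x - P.N φ x‖ ≤ ‖toBCF (d - φ)‖ * (2 * ‖P.N (χ k) x‖) := by
      refine (ae_ball_iff h.countable).2 fun d _ => eventually_imp_distrib_left.2 fun hd => ?_
      filter_upwards [hP.norm_le (hχ k) (hχK k) (tsupport_sub_subset hd hk),
        P.coeFn_N_sub d φ] with x h1 e1
      rwa [e1] at h1
    filter_upwards [hφ, hS1] with x h1 hx
    have hval : ∀ d ∈ D, eval d (Φ x) = P.N d x := fun d hd => by
      rw [hΦ x d hd, Set.indicator_of_mem hx]
    -- Both sides are within the same multiple of `‖d - φ‖` of the common value at `d ∈ D`.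
    refine eq_of_forall_dist_le fun ε hε => ?_
    set M : ℝ := ‖P.N (χ k) x‖ + 1
    have hM0 : 0 < M := by positivity
    have hM1 : ‖P.N (χ k) x‖ ≤ M := (lt_add_one _).le
    obtain ⟨d, hd, hdK, hdφ, -⟩ := h.approx k φ hk (ε / (4 * M)) (by positivity)
    have b1 : ‖toBCF (d - φ)‖ * (2 * ‖P.N (χ k) x‖) ≤ ε / 2 := by
      calc _ ≤ ε / (4 * M) * (2 * M) := by gcongr
        _ = ε / 2 := by field_simp; norm_num
    have b2 := norm_eval_le (hχ k) (hχK k) (tsupport_sub_subset hdK hk) (Φ x)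
    rw [eval_sub, hval d hd, hval _ (hχD k)] at b2
    have b3 := h1 d hd hdK
    rw [dist_eq_norm]
    calc ‖eval φ (Φ x) - P.N φ x‖ = ‖(P.N d x - P.N φ x) - (P.N d x - eval φ (Φ x))‖ := by
          congr 1; ring
      _ ≤ ε := (norm_sub_le _ _).trans (by linarith)

/-! ### Factor maps of full processes -/

/-- A factor map through which `P.N` factors induces a spatial isomorphism if `P` is full:
composition with it is an isometry between the `L²`-spaces, and its closed range contains the
products `ϑ₁(N(φ₁)) ⋯ ϑₙ(N(φₙ))`. -/
theorem IsFull.equivalent_of_factorMap {P : SpatialProcess G X} (hP : P.IsFull)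
    (Q : SpatialProcess G Y) {Φ : X → Y} (hΦ : MeasurePreserving Φ P.m Q.m)
    (hN : ∀ φ, (fun x => Q.N φ (Φ x)) =ᵐ[P.m] P.N φ)
    (hvadd : ∀ t : G, ∀ᵐ x ∂P.m, Φ (t +ᵥ x) = t +ᵥ Φ x) : P.Equivalent Q := by
  let V : Lp ℂ 2 Q.m →ₗᵢ[ℂ] Lp ℂ 2 P.m := Lp.compMeasurePreservingₗᵢ ℂ Φ hΦ
  have hV : ∀ f, V f =ᵐ[P.m] fun x => f (Φ x) := fun f => Lp.coeFn_compMeasurePreserving f hΦ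
  -- An equality of functions on `Y` can be tested after composition with `Φ`.
  have hVinj : ∀ (f : Lp ℂ 2 Q.m) (g : Y → ℂ), Measurable g →
      (V f =ᵐ[P.m] fun x => g (Φ x)) → f =ᵐ[Q.m] g := by
    intro f g hg hfg
    have hs := measurableSet_eq_fun (Lp.stronglyMeasurable f).measurable hg
    have h0 : P.m (Φ ⁻¹' {y | f y = g y}ᶜ) = 0 :=
      ae_iff.1 (show ∀ᵐ x ∂P.m, f (Φ x) = g (Φ x) from (hV f).symm.trans hfg)
    rwa [hΦ.measure_preimage hs.compl.nullMeasurableSet] at h0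
  have hsurj : Function.Surjective V := by
    have hcl : IsClosed (Set.range V) := V.isometry.isClosedEmbedding.isClosed_range
    have hspan : Submodule.span ℂ {f : Lp ℂ 2 P.m | ∃ (n : ℕ) (ϑ : Fin n → C_c(ℂ, ℂ))
        (φ : Fin n → C_c(G, ℂ)), 0 < n ∧ f =ᵐ[P.m] fun x => ∏ j, ϑ j (P.N (φ j) x)} ≤
        LinearMap.range V.toLinearMap := by
      refine Submodule.span_le.2 ?_
      rintro f ⟨n, ϑ, φ, -, hf⟩
      have hmem : MemLp (fun y => ∏ j, ϑ j (Q.N (φ j) y)) 2 Q.m := by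
        refine MemLp.of_bound (C := ∏ j, ‖toBCF (ϑ j)‖) ?_ (ae_of_all _ fun y => ?_)
        · refine Measurable.aestronglyMeasurable ?_
          exact Finset.measurable_prod _ fun j _ => (ϑ j).continuous.measurable.comp
            (Lp.stronglyMeasurable (Q.N (φ j))).measurable
        · rw [norm_prod]
          exact Finset.prod_le_prod (fun _ _ => norm_nonneg _) fun j _ => norm_apply_le (ϑ j) _
      refine ⟨hmem.toLp _, Lp.ext ?_⟩
      filter_upwards [hV (hmem.toLp _), hΦ.quasiMeasurePreserving.ae hmem.coeFn_toLp, hf,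
        ae_all_iff.2 fun j => hN (φ j)] with x e1 e2 e3 e4
      refine e1.trans (e2.trans (Eq.trans ?_ e3.symm))
      exact Finset.prod_congr rfl fun j _ => congrArg (ϑ j) (e4 j)
    have hd := hP.mono (show _ ⊆ Set.range V from hspan)
    exact Set.range_eq_univ.1 (hcl.closure_eq ▸ hd.closure_eq)
  let W : Lp ℂ 2 Q.m ≃ₗᵢ[ℂ] Lp ℂ 2 P.m := LinearIsometryEquiv.ofSurjective V hsurj
  have hW : ∀ f, W f = V f := fun _ => rfl
  refine ⟨W.symm, fun φ => ?_, fun t f => ?_, fun f g e _ _ he => ?_, fun f g e _ _ he => ?_⟩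
  · rw [LinearIsometryEquiv.symm_apply_eq]
    exact Lp.ext ((hN φ).symm.trans (hV _).symm)
  · obtain ⟨f, rfl⟩ := W.surjective f
    rw [LinearIsometryEquiv.symm_apply_eq, LinearIsometryEquiv.symm_apply_apply, hW, hW]
    refine Lp.ext ?_
    filter_upwards [P.coeFn_koopman t (V f), hV (koopman Q.m t f),
      (measurePreserving_vadd (-t) P.m).quasiMeasurePreserving.ae (hV f),
      hΦ.quasiMeasurePreserving.ae (Q.coeFn_koopman t f), hvadd (-t)] with x e1 e2 e3 e4 e5
    rw [e1, e2, e3, e4, e5]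
  · obtain ⟨f, rfl⟩ := W.surjective f
    obtain ⟨g, rfl⟩ := W.surjective g
    obtain ⟨e, rfl⟩ := W.surjective e
    simp only [LinearIsometryEquiv.symm_apply_apply]
    refine hVinj e _ ((Lp.stronglyMeasurable f).measurable.mul
      (Lp.stronglyMeasurable g).measurable) ?_
    filter_upwards [he, hV f, hV g] with x e1 e2 e3
    rw [hW] at e1
    rw [e1, hW, hW, e2, e3]
  · rw [LinearIsometryEquiv.symm_symm, hW, hW, hW]
    filter_upwards [hV e, hV f, hV g, hΦ.quasiMeasurePreserving.ae he] with x e1 e2 e3 e4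
    rw [e1, e2, e3, e4]

end SpatialProcess

theorem mainTheorem2 {G : Type*} [AddCommGroup G] [TopologicalSpace G] [IsTopologicalAddGroup G]
    [LocallyCompactSpace G] [T2Space G] [SecondCountableTopology G]
    [MeasurableSpace G] [BorelSpace G]
    {X : Type*} [MeasurableSpace X] [AddAction G X] [MeasurableVAdd G X]
    (P : SpatialProcess G X) (hfull : P.IsFull) (hpos : P.IsPositive) :
    ∃ (m' : Measure (PositiveMeasures G)) (hprob : IsProbabilityMeasure m')
      (hinv : VAddInvariantMeasure G (PositiveMeasures G) m')
      (hm' : PositiveMeasures.SquareIntegrable m'),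
      P.Equivalent (PositiveMeasures.process m' hprob hinv hm') := by
  obtain ⟨Φ, hΦm, hΦ⟩ := hpos.exists_measurable_map
  obtain ⟨D, K, h⟩ := CcSpace.exists_isApproximating (G := G)
  have hvadd : ∀ t : G, ∀ᵐ x ∂P.m, Φ (t +ᵥ x) = t +ᵥ Φ x := by
    intro t
    have hev : ∀ᵐ x ∂P.m, ∀ d ∈ D, PositiveMeasures.eval d (Φ (t +ᵥ x)) =
        PositiveMeasures.eval d (t +ᵥ Φ x) := by
      refine (ae_ball_iff h.countable).2 fun d _ => ?_
      have hk := P.coeFn_koopman (-t) (P.N d)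
      rw [P.koopman_N, neg_neg] at hk
      filter_upwards [hk, hΦ (CcSpace.translate (-t) d),
        (measurePreserving_vadd t P.m).quasiMeasurePreserving.ae (hΦ d)] with x e1 e2 e3
      rw [PositiveMeasures.eval_vadd, e3, ← e1, e2]
    filter_upwards [hev] with x hx using h.ext_eval_mem hx
  have hmp : MeasurePreserving Φ P.m (P.m.map Φ) := hΦm.measurePreserving P.m
  have hprob : IsProbabilityMeasure (P.m.map Φ) := Measure.isProbabilityMeasure_map hΦm.aemeasurable
  have hinv : VAddInvariantMeasure G (PositiveMeasures G) (P.m.map Φ) := by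
    refine ⟨fun t s hs => ?_⟩
    have hts : MeasurableSet ((fun ν : PositiveMeasures G => t +ᵥ ν) ⁻¹' s) :=
      measurable_const_vadd t hs
    rw [Measure.map_apply hΦm hts, Measure.map_apply hΦm hs,
      ← measure_preimage_vadd P.m t (Φ ⁻¹' s)]
    refine measure_congr ?_
    filter_upwards [hvadd t] with x hx
    exact congrArg (· ∈ s) hx.symm
  have hm' : PositiveMeasures.SquareIntegrable (P.m.map Φ) := by
    intro φ
    rw [lintegral_map ((PositiveMeasures.continuous_eval φ).measurable.enorm.pow_const 2) hΦm]
    have e : ∀ᵐ x ∂P.m, ‖PositiveMeasures.eval φ (Φ x)‖ₑ ^ 2 = ‖P.N φ x‖ₑ ^ 2 := by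
      filter_upwards [hΦ φ] with x hx
      rw [hx]
    rw [lintegral_congr_ae e]
    simpa using (eLpNorm_lt_top_iff_lintegral_rpow_enorm_lt_top two_ne_zero
      ENNReal.ofNat_ne_top).1 (Lp.memLp (P.N φ)).2
  refine ⟨P.m.map Φ, hprob, hinv, hm', hfull.equivalent_of_factorMap _ hmp (fun φ => ?_) hvadd⟩
  exact (hmp.quasiMeasurePreserving.ae_eq_comp (hm'.memLp φ).coeFn_toLp).trans (hΦ φ)
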